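/- All graphs are nonempty, finite, loopless multigraphs, and $\mathbb{N}=\{1,2,3,\dots\}$. For a graph $G$, $\chi(G)$ is its chromatic number and $P(G,m)$ is the number of proper colorings of $G$ with colors from $\{1,\dots,m\}$. A cover of $G$ is a triple $\mathcal{H}=(L,H,M)$ where $L(v)=\{(v,a):a\in A_v\}$ with $A_v$ a nonempty finite set for each $v\in V(G)$, $H$ is a multigraph with vertex set $\bigcup_v L(v)$, and $M$ assigns to each edge $e$ of $G$ with endpoints $u,v$ a matching $M(e)$ each edge of which has one endpoint in $L(u)$ and the other in $L(v)$, such that: each $H[L(u)]$ is a complete graph (without parallel edges); $M(e_1)\cap M(e_2)=\emptyset$ for distinct edges $e_1,e_2$; and for distinct $u,v$ the set of edges of $H$ between $L(u)$ and $L(v)$ is the union of the $M(e)$ over all edges $e$ of $G$ with endpoints $u,v$. The cover is $m$-fold if $|L(u)|=m$ for all $u$, and a full $m$-fold cover if moreover there are exactly $e_G(u,v)\,m$ edges of $H$ between $L(u)$ and $L(v)$ for all distinct $u,v$, where $e_G(u,v)$ is the number of edges of $G$ with endpoints $u,v$. An $\mathcal{H}$-coloring is an independent set of $H$ of size $|V(G)|$.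 The DP-chromatic number $\chi_{DP}(G)$ is the smallest $k\in\mathbb{N}$ such that an $\mathcal{H}$-coloring exists for every $k$-fold cover $\mathcal{H}$ of $G$, and the DP color function $P_{DP}(G,m)$ is the minimum number of $\mathcal{H}$-colorings over all full $m$-fold covers $\mathcal{H}$ of $G$. A function $f$ of graphs and positive integers is chromatic-adherent at $G$ if $f(G,a)=P(G,a)$ for some $a\ge\chi(G)$ implies $f(G,m)=P(G,m)$ for all $m\ge a$, and chromatic-adherent if it is so at every graph $G$. Theorem. There are infinitely many graphs $G$ for which $\chi_{DP}(G)=3$, $P_{DP}(G,3)=P(G,3)$, and there is an $N_G\in\mathbb{N}$ such that $P_{DP}(G,m)<P(G,m)$ whenever $m\ge N_G$. More precisely, for $k\in\mathbb{N}$ let $H_k$ be the simple graph obtained from the join $K_1\vee P_{2k+2}$ of a single vertex and the path on $2k+2$ vertices by adding a new vertex $z$ and an edge between $z$ and each of the two endpoints of $P_{2k+2}$. Then the graphs $H_k$ $(k\in\mathbb{N})$ are pairwise non-isomorphic, and every $H_k$ has these three properties. In particular $P_{DP}$ is not chromatic-adherent at any $H_k$, and hence $P_{DP}$ is not chromatic-adherent.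 -/

import Mathlib

namespace DPColoring

open scoped Graph

/-- Nonempty, finite, loopless multigraphs. (`Graph α β` is Mathlib's type of multigraphs
with vertices in `α` and edges in `β`.) -/
structure IsFiniteLoopless {α β : Type} (G : Graph α β) : Prop where
  vertexSet_nonempty : V(G).Nonempty
  vertexSet_finite : V(G).Finite
  edgeSet_finite : E(G).Finite
  loopless : G.Loopless

/-- Isomorphism of multigraphs: bijections between the vertices and between the edges that
preserve and reflect incidence. -/
def Isomorphic {α β α' β' : Type} (G : Graph α β) (G' : Graph α' β') : Prop :=
  ∃ (φ : V(G) ≃ V(G')) (ψ : E(G) ≃ E(G')), ∀ (e : E(G)) (u v : V(G)),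
    G.IsLink e u v ↔ G'.IsLink (ψ e) (φ u) (φ v)

/-- The set `E_G(u, v)` of edges of `G` with endpoints `u` and `v`. -/
def edgesBetween {α β : Type} (G : Graph α β) (u v : α) : Set β := {e | G.IsLink e u v}

/-- The set `E_G(S, U)` of edges of `G` with one endpoint in `S` and the other in `U`. -/
def edgesBetweenSets {α β : Type} (G : Graph α β) (S U : Set α) : Set β :=
  {e | ∃ x ∈ S, ∃ y ∈ U, G.IsLink e x y}

/-- `I` is an independent set of vertices of `G`. -/
def IsIndependent {α β : Type} (G : Graph α β) (I : Set α) : Prop :=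
  I ⊆ V(G) ∧ ∀ x ∈ I, ∀ y ∈ I, ¬ G.Adj x y

/-- `F` is a matching of `G`: a set of edges that are not loops and pairwise share no endpoint. -/
def IsMatching {α β : Type} (G : Graph α β) (F : Set β) : Prop :=
  F ⊆ E(G) ∧ (∀ f ∈ F, ∀ x, ¬ G.IsLoopAt f x) ∧
    ∀ f ∈ F, ∀ f' ∈ F, f ≠ f' → ∀ x, ¬ (G.Inc f x ∧ G.Inc f' x)

/-! ### Chromatic polynomial and chromatic number -/

/-- `c` is a proper `m`-coloring of `G`. -/
def IsProperColoring {α β : Type} (G : Graph α β) (m : ℕ) (c : V(G) → Fin m) : Prop :=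
  ∀ u v : V(G), G.Adj u v → c u ≠ c v

/-- `P(G, m)`: the number of proper `m`-colorings of `G`. -/
noncomputable def P {α β : Type} (G : Graph α β) (m : ℕ) : ℕ :=
  {c : V(G) → Fin m | IsProperColoring G m c}.ncard

/-- The chromatic number `χ(G)`. -/
noncomputable def chi {α β : Type} (G : Graph α β) : ℕ :=
  sInf {k | ∃ c : V(G) → Fin k, IsProperColoring G k c}

/-! ### Covers and DP-coloring -/

/-- A cover `(L, H, M)` of the multigraph `G`. Here `A v` is the nonempty finite set of colors
available at `v`, and `L(v) = {(v, a) : a ∈ A v}`. -/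
structure Cover {α β : Type} (G : Graph α β) where
  /-- the set of colors at a vertex -/
  A : V(G) → Type
  A_nonempty : ∀ v, Nonempty (A v)
  A_finite : ∀ v, Finite (A v)
  /-- the type of the edges of `H` -/
  EdgeType : Type
  /-- the multigraph `H` -/
  H : Graph (Σ v, A v) EdgeType
  /-- the vertex set of `H` is the union of all the `L(v)` -/
  vertexSet_H : V(H) = Set.univ
  loopless_H : H.Loopless
  /-- the assignment `M` -/
  M : E(G) → Set EdgeType
  isMatching_M : ∀ e, IsMatching H (M e)
  /-- each edge of `M(e)` has one endpoint in `L(u)` and the other in `L(v)`, where `u, v` are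
  the endpoints of `e` -/
  M_subset : ∀ (e : E(G)) (u v : V(G)), G.IsLink e u v →
    M e ⊆ edgesBetweenSets H {x | x.1 = u} {x | x.1 = v}
  /-- `H[L(u)]` is a complete (simple) graph -/
  complete : ∀ (u : V(G)) (a b : A u), a ≠ b → ∃! f, H.IsLink f ⟨u, a⟩ ⟨u, b⟩
  /-- distinct edges have disjoint matchings -/
  disjoint : ∀ e₁ e₂ : E(G), e₁ ≠ e₂ → M e₁ ∩ M e₂ = ∅
  /-- the edges between `L(u)` and `L(v)` are those of the matchings -/
  between : ∀ u v : V(G), u ≠ v →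
    edgesBetweenSets H {x | x.1 = u} {x | x.1 = v} = ⋃ e ∈ {e : E(G) | G.IsLink e u v}, M e

namespace Cover

variable {α β : Type} {G : Graph α β}

/-- The set `L(v)` of vertices of `H`. -/
def L (C : Cover G) (v : V(G)) : Set (Σ v, C.A v) := {x | x.1 = v}

/-- An `𝓗`-coloring of `G`: an independent set in `H` of size `|V(G)|`. -/
def IsColoring (C : Cover G) (I : Set (Σ v, C.A v)) : Prop :=
  IsIndependent C.H I ∧ I.ncard = V(G).ncard

/-- The number `P_DP(G, 𝓗)` of `𝓗`-colorings. -/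
noncomputable def numColorings (C : Cover G) : ℕ := {I | C.IsColoring I}.ncard

/-- The cover is `m`-fold: `|L(u)| = m` for all `u`. -/
def IsFold (C : Cover G) (m : ℕ) : Prop := ∀ u, (C.L u).ncard = m

/-- The cover is a full `m`-fold cover. -/
def IsFullFold (C : Cover G) (m : ℕ) : Prop :=
  C.IsFold m ∧ ∀ u v : V(G), u ≠ v →
    (edgesBetweenSets C.H (C.L u) (C.L v)).ncard = (edgesBetween G u v).ncard * m

end Cover

/-- The DP-chromatic number `χ_DP(G)`: the smallest positive integer `k` such that every `k`-fold
cover of `G` admits a coloring. (No cover of a nonempty graph is `0`-fold.) -/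
noncomputable def chiDP {α β : Type} (G : Graph α β) : ℕ :=
  sInf {k | 0 < k ∧ ∀ C : Cover G, C.IsFold k → ∃ I, C.IsColoring I}

/-- The DP color function `P_DP(G, m)`: the minimum of `P_DP(G, 𝓗)` over all full `m`-fold
covers `𝓗` of `G`. -/
noncomputable def PDP {α β : Type} (G : Graph α β) (m : ℕ) : ℕ :=
  sInf {n | ∃ C : Cover G, C.IsFullFold m ∧ C.numColorings = n}

/-- A function `f` of multigraphs and positive integers is chromatic-adherent at `G`:
`f(G, a) = P(G, a)` for some `a ≥ χ(G)` implies `f(G, m) = P(G, m)` for all `m ≥ a`. -/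
def IsChromaticAdherentAt (f : ∀ {α β : Type}, Graph α β → ℕ → ℕ) {α β : Type}
    (G : Graph α β) : Prop :=
  ∀ a : ℕ, chi G ≤ a → f G a = P G a → ∀ m, a ≤ m → f G m = P G m

/-- `f` is chromatic-adherent: it is so at every nonempty finite loopless multigraph. -/
def IsChromaticAdherent (f : ∀ {α β : Type}, Graph α β → ℕ → ℕ) : Prop :=
  ∀ (α β : Type) (G : Graph α β), IsFiniteLoopless G → IsChromaticAdherentAt f G

/-! ### The graphs `H_k` -/

/-- The join `G ∨ H` of two (vertex disjoint) simple graphs. -/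
def join {V W : Type} (G : SimpleGraph V) (H : SimpleGraph W) : SimpleGraph (V ⊕ W) :=
  G.sum H ⊔ completeBipartiteGraph V W

/-- `K₁ ∨ P_{2k+2}` together with a new vertex `z = none` joined to the two endpoints of the
path `P_{2k+2}`, as a simple graph. -/
def simpleHk (k : ℕ) : SimpleGraph (Option (Fin 1 ⊕ Fin (2 * k + 2))) :=
  (join (⊤ : SimpleGraph (Fin 1)) (SimpleGraph.pathGraph (2 * k + 2))).map
      some ⊔
    SimpleGraph.edge none (some (Sum.inr 0)) ⊔
    SimpleGraph.edge none (some (Sum.inr (Fin.last (2 * k + 1))))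

/-- The graph `H_k` as a multigraph (without parallel edges). -/
def Hk (k : ℕ) :
    Graph (Option (Fin 1 ⊕ Fin (2 * k + 2))) (Sym2 (Option (Fin 1 ⊕ Fin (2 * k + 2)))) :=
  Graph.ofSimpleGraph (simpleHk k)

end DPColoring

namespace DPColoring

open scoped Graph

/-! Write w for the hub, p_0, ..., p_{2k+1} for the path and z for the extra vertex.

Three colors. In the order w, p_0, p_1, ..., p_{2k+1}, z, every vertex after p_0 has exactly two
earlier neighbors. In a 3-fold cover each of these forbids at most one color, so every conflict-free
choice at (w, p_0) extends greedily. At most 3 of the 9 pairs conflict, which leaves at least 6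
colorings (`six_le_numColorings`). Conversely, an ordinary 3-coloring is determined by its values at
w and p_0: the path alternates between the two colors other than that of w, its ends differ because
the number of vertices is even, and z must repeat the color of w. Hence P ≤ 6 (`P_Hk_three_le`), and
the two counts agree.

Many colors. Twist the identity cover by a permutation ρ on the single edge z p_0. A coloring of the
fan on w and the path extends to z in m - 2 ways, plus one if ρ(c(p_0)) = c(p_{2k+1})
(`numColorings_twist`). It remains to compare fan colorings with ends (i, ρ i) and with ends (i, i).
For a fixed hub color, an odd path has α colorings with given equal ends and α + 1 with given
distinct ends. Distinct ends leave the hub m - 2 colors, equal ends m - 1. So a fixed-point-free ρ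
gives strictly fewer colorings once (m - 2)(α + 1) < (m - 1)α, that is, once m - 2 < α, which holds
for k ≥ 1 and m ≥ 5. -/

theorem simpleHk_adj_some {k : ℕ} {x y : Fin 1 ⊕ Fin (2 * k + 2)} :
    (simpleHk k).Adj (some x) (some y) ↔
      (join (⊤ : SimpleGraph (Fin 1)) (SimpleGraph.pathGraph (2 * k + 2))).Adj x y := by
  simp only [simpleHk, SimpleGraph.sup_adj, SimpleGraph.edge_adj, SimpleGraph.map_adj']
  constructor
  · rintro ((⟨-, x', y', h, hx, hy⟩ | ⟨h, -⟩) | ⟨h, -⟩)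
    · rwa [← Option.some.inj hx, ← Option.some.inj hy]
    · simp at h
    · simp at h
  · exact fun h => Or.inl (Or.inl ⟨fun hxy => h.ne (Option.some.inj hxy), x, y, h, rfl, rfl⟩)

theorem simpleHk_adj_none {k : ℕ} {v : Option (Fin 1 ⊕ Fin (2 * k + 2))} :
    (simpleHk k).Adj none v ↔
      v = some (Sum.inr 0) ∨ v = some (Sum.inr (Fin.last (2 * k + 1))) := by
  simp only [simpleHk, SimpleGraph.sup_adj, SimpleGraph.edge_adj, SimpleGraph.map_adj']
  constructor
  · rintro ((⟨-, x', y', h, hx, hy⟩ | ⟨h, -⟩) | ⟨h, -⟩)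
    · simp at hx
    · simp_all
    · simp_all
  · rintro (rfl | rfl) <;> simp

/-- A symmetric relation holds along all edges of `H_k` if it holds along the spokes, along the
path and along the two edges at the extra vertex. -/
theorem forall_adj_simpleHk_iff {k : ℕ}
    {Q : Option (Fin 1 ⊕ Fin (2 * k + 2)) → Option (Fin 1 ⊕ Fin (2 * k + 2)) → Prop}
    (hQ : ∀ u v, Q u v → Q v u) :
    (∀ u v, (simpleHk k).Adj u v → Q u v) ↔
      (∀ i, Q (some (Sum.inl 0)) (some (Sum.inr i))) ∧
      (∀ i : Fin (2 * k + 1), Q (some (Sum.inr i.castSucc)) (some (Sum.inr i.succ))) ∧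
      Q none (some (Sum.inr 0)) ∧ Q none (some (Sum.inr (Fin.last (2 * k + 1)))) := by
  constructor
  · intro h
    refine ⟨fun i => h _ _ ?_, fun i => h _ _ ?_, h _ _ ?_, h _ _ ?_⟩
    · simp [simpleHk_adj_some, join]
    · simp [simpleHk_adj_some, join, SimpleGraph.pathGraph_adj]
    · simp [simpleHk_adj_none]
    · simp [simpleHk_adj_none]
  · rintro ⟨h1, h2, h3, h4⟩
    have h2' : ∀ i j : Fin (2 * k + 2), i.val + 1 = j.val →
        Q (some (Sum.inr i)) (some (Sum.inr j)) := by
      intro i j hij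
      have hi : i.val < 2 * k + 1 := by omega
      have hj : j = Fin.succ ⟨i.val, hi⟩ := Fin.ext hij.symm
      rw [hj]
      exact h2 ⟨i.val, hi⟩
    have h0 : ∀ v, (simpleHk k).Adj none v → Q none v := by
      intro v huv
      rcases simpleHk_adj_none.1 huv with rfl | rfl
      · exact h3
      · exact h4
    intro u v huv
    rcases u with _ | u
    · exact h0 _ huv
    rcases v with _ | v
    · exact hQ _ _ (h0 _ huv.symm)
    rw [simpleHk_adj_some] at huv
    rcases u with a | i <;> rcases v with b | j
    · exact absurd (Subsingleton.elim a b) (by simpa [join] using huv)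
    · rw [Subsingleton.elim a 0]
      exact h1 _
    · rw [Subsingleton.elim b 0]
      exact hQ _ _ (h1 _)
    · simp only [join, SimpleGraph.sup_adj, SimpleGraph.sum_adj, SimpleGraph.pathGraph_adj,
        completeBipartiteGraph_adj, Sum.isLeft_inr, Sum.isRight_inr, Bool.false_eq_true,
        false_and, and_false, or_false] at huv
      rcases huv with h | h
      · exact h2' _ _ h
      · exact hQ _ _ (h2' _ _ h)

/-! ### Cover colorings as transversals -/

namespace Cover

variable {α β : Type} {G : Graph α β}

/-- A choice of one color at every vertex with no conflict in `H`. -/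
def IsTransversal (C : Cover G) (f : ∀ v, C.A v) : Prop :=
  ∀ u v, ¬ C.H.Adj ⟨u, f u⟩ ⟨v, f v⟩

/-- Each L(v) is a clique, so an independent set meets it at most once; having |V(G)| elements
forces exactly once. -/
theorem isColoring_iff (C : Cover G) (hG : V(G).Finite) (I : Set (Σ v, C.A v)) :
    C.IsColoring I ↔ ∃ f, C.IsTransversal f ∧ Set.range (fun v => ⟨v, f v⟩) = I := by
  have : Finite V(G) := hG
  have := C.A_finite
  constructor
  · rintro ⟨⟨-, hI⟩, hcard⟩
    have hinj : Set.InjOn Sigma.fst I := by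
      rintro ⟨u, a⟩ ha ⟨v, b⟩ hb (rfl : u = v)
      by_contra hne
      obtain ⟨f, hf, -⟩ := C.complete u a b (fun h => hne (by rw [h]))
      exact hI _ ha _ hb ⟨f, hf⟩
    have himg : Sigma.fst '' I = Set.univ := by
      refine Set.eq_of_subset_of_ncard_le (Set.subset_univ _) ?_
      rw [hinj.ncard_image, hcard, Set.ncard_univ, Nat.card_coe_set_eq]
    have hex : ∀ v, ∃ a, (⟨v, a⟩ : Σ v, C.A v) ∈ I := by
      intro v
      obtain ⟨⟨u, a⟩, ha, rfl⟩ : v ∈ Sigma.fst '' I := himg ▸ Set.mem_univ v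
      exact ⟨a, ha⟩
    choose f hf using hex
    refine ⟨f, fun u v => hI _ (hf u) _ (hf v), Set.Subset.antisymm ?_ ?_⟩
    · rintro _ ⟨v, rfl⟩
      exact hf v
    · intro x hx
      exact ⟨x.1, hinj (hf _) hx rfl⟩
  · rintro ⟨f, hf, rfl⟩
    refine ⟨⟨by simp [C.vertexSet_H], ?_⟩, ?_⟩
    · rintro _ ⟨u, rfl⟩ _ ⟨v, rfl⟩
      exact hf u v
    · rw [← Set.image_univ, Set.ncard_image_of_injective, Set.ncard_univ, Nat.card_coe_set_eq]
      intro u v h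
      exact congrArg Sigma.fst h

theorem numColorings_eq (C : Cover G) (hG : V(G).Finite) :
    C.numColorings = {f | C.IsTransversal f}.ncard := by
  have hinj : Function.Injective
      (fun (f : ∀ v, C.A v) => Set.range (fun v => (⟨v, f v⟩ : Σ v, C.A v))) := by
    intro f g h
    funext v
    have hv : (⟨v, f v⟩ : Σ v, C.A v) ∈ Set.range (fun v => (⟨v, g v⟩ : Σ v, C.A v)) := by
      simp only at h
      rw [← h]
      exact ⟨v, rfl⟩
    obtain ⟨w, hw⟩ := hv
    obtain ⟨rfl, h2⟩ := Sigma.mk.inj hw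
    exact (eq_of_heq h2).symm
  rw [numColorings, ← Set.ncard_image_of_injective _ hinj]
  congr 1
  ext I
  simp [C.isColoring_iff hG]

theorem exists_isLink_of_adj (C : Cover G) {u v : V(G)} (huv : u ≠ v) {a : C.A u} {b : C.A v}
    {f : C.EdgeType} (h : C.H.IsLink f ⟨u, a⟩ ⟨v, b⟩) :
    ∃ e : E(G), G.IsLink e u v ∧ f ∈ C.M e := by
  have hf : f ∈ edgesBetweenSets C.H {x | x.1 = u} {x | x.1 = v} :=
    ⟨⟨u, a⟩, rfl, ⟨v, b⟩, rfl, h⟩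
  rw [C.between u v huv] at hf
  simpa using hf

/-- In a simple graph all cover edges between L(u) and L(v) come from one matching, so a color at u
forbids at most one color at v. -/
theorem eq_of_adj_of_adj (C : Cover G) (hG : G.Simple) {u v : V(G)} (huv : u ≠ v)
    {a : C.A u} {b b' : C.A v} (h : C.H.Adj ⟨u, a⟩ ⟨v, b⟩) (h' : C.H.Adj ⟨u, a⟩ ⟨v, b'⟩) :
    b = b' := by
  obtain ⟨f, hf⟩ := h
  obtain ⟨f', hf'⟩ := h'
  obtain ⟨e, he, hfe⟩ := C.exists_isLink_of_adj huv hf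
  obtain ⟨e', he', hfe'⟩ := C.exists_isLink_of_adj huv hf'
  obtain rfl : e = e' := Subtype.ext (he.eq he')
  obtain rfl : f = f' := by
    by_contra hne
    exact (C.isMatching_M e).2.2 f hfe f' hfe' hne ⟨u, a⟩ ⟨hf.inc_left, hf'.inc_left⟩
  have := hf.right_unique hf'
  simpa using this

theorem isTransversal_iff (C : Cover G) (f : ∀ v, C.A v) :
    C.IsTransversal f ↔ ∀ u v : V(G), G.Adj u v → ¬ C.H.Adj ⟨u, f u⟩ ⟨v, f v⟩ := by
  refine ⟨fun h u v _ => h u v, fun h u v huv => ?_⟩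
  have := C.loopless_H
  obtain ⟨g, hg⟩ := huv
  by_cases hne : u = v
  · subst hne
    exact hg.ne rfl
  · obtain ⟨e, he, -⟩ := C.exists_isLink_of_adj hne hg
    exact h u v he.adj hg.adj

theorem IsFold.card_eq {C : Cover G} {m : ℕ} (hC : C.IsFold m) (u : V(G)) :
    Nat.card (C.A u) = m := by
  rw [← hC u, ← Set.ncard_univ, ← Set.ncard_image_of_injective _ (sigma_mk_injective (i := u))]
  congr 1
  ext ⟨v, a⟩
  simp only [L, Set.image_univ, Set.mem_range, Set.mem_ofPred_eq]
  constructor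
  · rintro ⟨b, hb⟩
    exact (congrArg Sigma.fst hb).symm
  · rintro rfl
    exact ⟨a, rfl⟩

end Cover

/-! ### Greedy extension in 3-fold covers -/

theorem exists_not_and_not {A : Type} (hA : Nat.card A = 3) {R S : A → Prop}
    (hR : ∀ b b', R b → R b' → b = b') (hS : ∀ b b', S b → S b' → b = b') :
    ∃ b, ¬ R b ∧ ¬ S b := by
  have : Finite A := Nat.finite_of_card_ne_zero (by omega)
  by_contra! h
  have h1 : ({b | R b} : Set A).ncard ≤ 1 := (Set.ncard_le_one).2 fun b hb b' hb' => hR b b' hb hb'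
  have h2 : ({b | S b} : Set A).ncard ≤ 1 := (Set.ncard_le_one).2 fun b hb b' hb' => hS b b' hb hb'
  have h3 : ({b | R b} ∪ {b | S b} : Set A) = Set.univ := by
    ext b
    have := h b
    simp only [Set.mem_union, Set.mem_ofPred_eq, Set.mem_univ, iff_true]
    tauto
  have h4 := Set.ncard_union_le {b | R b} {b | S b}
  rw [h3, Set.ncard_univ] at h4
  omega

theorem simple_ofSimpleGraph {V : Type} (G : SimpleGraph V) :
    (Graph.ofSimpleGraph G).Simple where
  not_isLoopAt e x := by
    rintro ⟨rfl, h⟩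
    simp at h
  eq_of_isLink := by
    rintro e f x y ⟨rfl, -⟩ ⟨rfl, -⟩
    rfl

/-- Greedy colouring: the vertices of `H_k` can be ordered, beginning with any two adjacent ones
on the hub and the start of the path, so that each has at most two earlier neighbours. -/
theorem exists_isTransversal_of_isFold_three {k : ℕ} (C : Cover (Hk k)) (hC : C.IsFold 3)
    (a : C.A ⟨some (Sum.inl 0), trivial⟩) (b : C.A ⟨some (Sum.inr 0), trivial⟩)
    (hab : ¬ C.H.Adj ⟨_, a⟩ ⟨_, b⟩) :
    ∃ f, C.IsTransversal f ∧ f ⟨some (Sum.inl 0), trivial⟩ = a ∧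
      f ⟨some (Sum.inr 0), trivial⟩ = b := by
  have hs : (Hk k).Simple := simple_ofSimpleGraph _
  have key : ∀ (u v w : V(Hk k)), u ≠ w → v ≠ w → ∀ (x : C.A u) (y : C.A v),
      ∃ c : C.A w, ¬ C.H.Adj ⟨u, x⟩ ⟨w, c⟩ ∧ ¬ C.H.Adj ⟨v, y⟩ ⟨w, c⟩ :=
    fun u v w hu hv x y => exists_not_and_not (hC.card_eq w)
      (fun _ _ h h' => C.eq_of_adj_of_adj hs hu h h')
      (fun _ _ h h' => C.eq_of_adj_of_adj hs hv h h')
  let p (i : Fin (2 * k + 1 + 1)) : V(Hk k) := ⟨some (Sum.inr i), trivial⟩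
  have hstep : ∀ (i : Fin (2 * k + 1)) (x : C.A (p i.castSucc)), ∃ c : C.A (p i.succ),
      ¬ C.H.Adj ⟨_, a⟩ ⟨_, c⟩ ∧ ¬ C.H.Adj ⟨_, x⟩ ⟨_, c⟩ := by
    intro i x
    refine key _ _ _ ?_ ?_ _ _
    · exact fun h => by simpa [p] using congrArg Subtype.val h
    · exact fun h => (Fin.castSucc_lt_succ (i := i)).ne
        (Sum.inr.inj (Option.some.inj (congrArg Subtype.val h)))
  choose next hnext using hstep
  let g : ∀ i, C.A (p i) := fun i => Fin.induction (motive := fun i => C.A (p i)) b next i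
  -- The extra vertex comes last; its only neighbors are the two ends of the path.
  obtain ⟨c, hc1, hc2⟩ := key (p 0) (p (Fin.last _)) ⟨none, trivial⟩
    (fun h => by simpa [p] using congrArg Subtype.val h)
    (fun h => by simpa [p] using congrArg Subtype.val h) (g 0) (g (Fin.last _))
  let f : ∀ v, C.A v := fun v => match v with
    | ⟨none, _⟩ => c
    | ⟨some (Sum.inl 0), _⟩ => a
    | ⟨some (Sum.inr i), _⟩ => g i
  refine ⟨f, ?_, rfl, rfl⟩
  rw [C.isTransversal_iff]
  have := (forall_adj_simpleHk_iff (k := k) (Q := fun u v =>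
    ¬ C.H.Adj ⟨⟨u, trivial⟩, f ⟨u, trivial⟩⟩ ⟨⟨v, trivial⟩, f ⟨v, trivial⟩⟩)
    (fun u v h h' => h h'.symm)).2 ?_
  · rintro ⟨u, hu⟩ ⟨v, hv⟩ huv
    exact this u v ((Graph.ofSimpleGraph_adj_iff u v).1 huv)
  · refine ⟨fun i => ?_, fun i => (hnext i _).2, fun h => hc1 h.symm, fun h => hc2 h.symm⟩
    induction i using Fin.cases with
    | zero => exact hab
    | succ i => exact (hnext i _).1

theorem six_le_numColorings {k : ℕ} (C : Cover (Hk k)) (hC : C.IsFold 3) :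
    6 ≤ C.numColorings := by
  have hs : (Hk k).Simple := simple_ofSimpleGraph _
  have hfin : V(Hk k).Finite := Set.toFinite (Set.univ)
  have : Finite V(Hk k) := hfin
  have := C.A_finite
  rw [C.numColorings_eq hfin]
  let w : V(Hk k) := ⟨some (Sum.inl 0), trivial⟩
  let p : V(Hk k) := ⟨some (Sum.inr 0), trivial⟩
  have hwp : w ≠ p := fun h => by simpa [w, p] using congrArg Subtype.val h
  let B : Set (C.A w × C.A p) := {x | C.H.Adj ⟨w, x.1⟩ ⟨p, x.2⟩}
  -- The conflicting pairs form a partial matching, hence project injectively to the three colors of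
  -- the hub.
  have hB : B.ncard ≤ 3 := by
    have hinj : Set.InjOn Prod.fst B := by
      rintro ⟨a, b⟩ h ⟨a', b'⟩ h' (rfl : a = a')
      exact Prod.ext rfl (C.eq_of_adj_of_adj hs hwp h h')
    rw [← hinj.ncard_image, ← hC.card_eq w, ← Set.ncard_univ]
    exact Set.ncard_le_ncard (Set.subset_univ _)
  have htot := Set.ncard_add_ncard_compl B
  rw [Nat.card_prod, hC.card_eq, hC.card_eq] at htot
  have hle : Bᶜ.ncard ≤ ((fun f : ∀ v, C.A v => (f w, f p)) '' {f | C.IsTransversal f}).ncard := by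
    refine Set.ncard_le_ncard ?_
    rintro ⟨a, b⟩ hab
    obtain ⟨f, hf, rfl, rfl⟩ := exists_isTransversal_of_isFold_three C hC a b hab
    exact ⟨f, hf, rfl⟩
  have := Set.ncard_image_le (f := fun f : ∀ v, C.A v => (f w, f p))
    (Set.toFinite {f | C.IsTransversal f})
  omega

/-! ### Full covers from edge permutations -/

section permCover

variable {V : Type}

/-- The graph of the cover of `G` with `m` colors at every vertex in which color `a` at `u`
conflicts with color `t u v a` at the neighbour `v`. -/
def permCoverGraph (G : SimpleGraph V) (m : ℕ) (t : V → V → Equiv.Perm (Fin m))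
    (ht : ∀ u v, t v u = (t u v)⁻¹) :
    SimpleGraph (Σ _ : V(Graph.ofSimpleGraph G), Fin m) where
  Adj x y := (x.1 = y.1 ∧ x.2 ≠ y.2) ∨ (G.Adj x.1 y.1 ∧ t x.1 y.1 x.2 = y.2)
  symm := ⟨by
    rintro x y (⟨h, h'⟩ | ⟨h, h'⟩)
    · exact Or.inl ⟨h.symm, h'.symm⟩
    · refine Or.inr ⟨h.symm, ?_⟩
      simp [ht x.1.1 y.1.1, ← h']⟩
  loopless := ⟨by
    rintro x (⟨-, h⟩ | ⟨h, -⟩)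
    · exact h rfl
    · exact h.ne rfl⟩

theorem permCoverGraph_adj_of_ne {G : SimpleGraph V} {m : ℕ} {t : V → V → Equiv.Perm (Fin m)}
    {ht : ∀ u v, t v u = (t u v)⁻¹} {x y : Σ _ : V(Graph.ofSimpleGraph G), Fin m}
    (hxy : x.1 ≠ y.1) :
    (permCoverGraph G m t ht).Adj x y ↔ G.Adj x.1 y.1 ∧ t x.1 y.1 x.2 = y.2 := by
  simp [permCoverGraph, hxy]

/-- The matching of the cover edges above the edge `e`. -/
def permCoverMatching (G : SimpleGraph V) (m : ℕ) (t : V → V → Equiv.Perm (Fin m))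
    (e : E(Graph.ofSimpleGraph G)) : Set (Sym2 (Σ _ : V(Graph.ofSimpleGraph G), Fin m)) :=
  {f | ∃ x y, f = s(x, y) ∧ e.1 = s(x.1.1, y.1.1) ∧ t x.1 y.1 x.2 = y.2}

/-- The definition only provides some orientation of the pair; since `t v u` inverts `t u v`, the
condition then holds for the given orientation too. -/
theorem permCoverMatching_of_mem {G : SimpleGraph V} {m : ℕ} {t : V → V → Equiv.Perm (Fin m)}
    (ht : ∀ u v, t v u = (t u v)⁻¹) {e : E(Graph.ofSimpleGraph G)}
    {x y : Σ _ : V(Graph.ofSimpleGraph G), Fin m} (h : s(x, y) ∈ permCoverMatching G m t e) :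
    e.1 = s(x.1.1, y.1.1) ∧ t x.1 y.1 x.2 = y.2 := by
  obtain ⟨x', y', hxy, he, h⟩ := h
  rcases Sym2.eq_iff.1 hxy with ⟨rfl, rfl⟩ | ⟨rfl, rfl⟩
  · exact ⟨he, h⟩
  · refine ⟨he.trans Sym2.eq_swap, ?_⟩
    simp [ht y.1.1 x.1.1, ← h]

/-- The full cover of a simple graph given by a permutation of the colors along every edge. -/
def permCover (G : SimpleGraph V) (m : ℕ) [NeZero m] (t : V → V → Equiv.Perm (Fin m))
    (ht : ∀ u v, t v u = (t u v)⁻¹) : Cover (Graph.ofSimpleGraph G) where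
  A _ := Fin m
  A_nonempty _ := ⟨0⟩
  A_finite _ := inferInstance
  EdgeType := _
  H := Graph.ofSimpleGraph (permCoverGraph G m t ht)
  vertexSet_H := rfl
  loopless_H := (simple_ofSimpleGraph _).toLoopless
  M e := permCoverMatching G m t e
  isMatching_M e := by
    refine ⟨?_, fun f _ => (simple_ofSimpleGraph _).not_isLoopAt f, ?_⟩
    · rintro f ⟨x, y, rfl, he, h⟩
      refine Or.inr ⟨?_, h⟩
      have := e.2
      rw [he] at this
      exact this
    · rintro f hf f' hf' hne z ⟨⟨y, rfl, -⟩, ⟨y', rfl, -⟩⟩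
      refine hne ?_
      obtain ⟨he, h⟩ := permCoverMatching_of_mem ht hf
      obtain ⟨he', h'⟩ := permCoverMatching_of_mem ht hf'
      obtain ⟨u, b⟩ := y
      obtain ⟨u', b'⟩ := y'
      rw [he, Sym2.congr_right] at he'
      obtain rfl := Subtype.ext he'
      congr
      exact h.symm.trans h'
  M_subset := by
    rintro e u v ⟨he, -⟩ f ⟨x, y, rfl, he', h⟩
    have hadj : (permCoverGraph G m t ht).Adj x y := by
      refine Or.inr ⟨?_, h⟩
      have := e.2
      rw [he'] at this
      exact this
    rw [he] at he'
    rcases Sym2.eq_iff.1 he' with ⟨hu, hv⟩ | ⟨hu, hv⟩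
    · exact ⟨x, Subtype.ext hu.symm, y, Subtype.ext hv.symm, rfl, hadj⟩
    · exact ⟨y, Subtype.ext hu.symm, x, Subtype.ext hv.symm, Sym2.eq_swap, hadj⟩
  complete u a b hab := by
    refine ⟨s(⟨u, a⟩, ⟨u, b⟩), ⟨rfl, Or.inl ⟨rfl, hab⟩⟩, fun f hf => hf.1⟩
  disjoint e₁ e₂ hne := by
    ext f
    simp only [Set.mem_inter_iff, Set.mem_empty_iff_false, iff_false]
    rintro ⟨⟨x, y, rfl, he, -⟩, hf⟩
    exact hne (Subtype.ext (he.trans (permCoverMatching_of_mem ht hf).1.symm))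
  between u v huv := by
    ext f
    simp only [Set.mem_iUnion]
    constructor
    · rintro ⟨x, rfl, y, rfl, rfl, h⟩
      obtain ⟨h1, h2⟩ := (permCoverGraph_adj_of_ne (ht := ht) huv).1 h
      exact ⟨⟨s(x.1.1, y.1.1), h1⟩, ⟨rfl, h1⟩, x, y, rfl, rfl, h2⟩
    · rintro ⟨e, ⟨he, -⟩, x, y, rfl, he', h⟩
      have hadj : (permCoverGraph G m t ht).Adj x y := by
        refine Or.inr ⟨?_, h⟩
        have := e.2
        rw [he'] at this
        exact this
      rw [he] at he'
      rcases Sym2.eq_iff.1 he' with ⟨hu, hv⟩ | ⟨hu, hv⟩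
      · exact ⟨x, Subtype.ext hu.symm, y, Subtype.ext hv.symm, rfl, hadj⟩
      · exact ⟨y, Subtype.ext hu.symm, x, Subtype.ext hv.symm, Sym2.eq_swap, hadj⟩

section

variable (G : SimpleGraph V) (m : ℕ) [NeZero m] (t : V → V → Equiv.Perm (Fin m))
    (ht : ∀ u v, t v u = (t u v)⁻¹)

theorem isFold_permCover : (permCover G m t ht).IsFold m := by
  intro u
  have : (permCover G m t ht).L u =
      Set.range (fun a : Fin m => (⟨u, a⟩ : Σ _ : V(Graph.ofSimpleGraph G), Fin m)) := by
    ext ⟨v, a⟩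
    constructor
    · rintro (rfl : v = u)
      exact ⟨a, rfl⟩
    · rintro ⟨b, hb⟩
      exact (congrArg Sigma.fst hb).symm
  rw [this, ← Set.image_univ]
  refine (Set.ncard_image_of_injective _ fun a b h => ?_).trans ?_
  · exact eq_of_heq (Sigma.mk.inj h).2
  · rw [Set.ncard_univ, Nat.card_eq_fintype_card, Fintype.card_fin]

theorem isFullFold_permCover : (permCover G m t ht).IsFullFold m := by
  refine ⟨isFold_permCover G m t ht, fun u v huv => ?_⟩
  by_cases hadj : G.Adj u v
  · have h1 : edgesBetween (Graph.ofSimpleGraph G) u.1 v.1 = {s(u.1, v.1)} := by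
      ext e
      constructor
      · exact fun h => h.1
      · rintro rfl
        exact ⟨rfl, hadj⟩
    let φ : Fin m → Sym2 (Σ _ : V(Graph.ofSimpleGraph G), Fin m) :=
      fun a => s(⟨u, a⟩, ⟨v, t u v a⟩)
    have h2 : edgesBetweenSets (permCover G m t ht).H ((permCover G m t ht).L u)
        ((permCover G m t ht).L v) = Set.range φ := by
      ext f
      constructor
      · rintro ⟨x, rfl, y, rfl, rfl, h⟩
        obtain ⟨-, h⟩ := (permCoverGraph_adj_of_ne (ht := ht) huv).1 h
        refine ⟨x.2, ?_⟩
        simp only [φ]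
        rw [h]
        rfl
      · rintro ⟨a, rfl⟩
        exact ⟨_, rfl, _, rfl, rfl, Or.inr ⟨hadj, rfl⟩⟩
    have hφ : Function.Injective φ := by
      intro a b h
      rcases Sym2.eq_iff.1 h with ⟨h, -⟩ | ⟨h, -⟩
      · simpa using h
      · exact absurd (congrArg Sigma.fst h) huv
    rw [h1, h2, Set.ncard_singleton, one_mul, ← Set.image_univ]
    refine (Set.ncard_image_of_injective _ hφ).trans ?_
    rw [Set.ncard_univ, Nat.card_eq_fintype_card, Fintype.card_fin]
  · have h1 : edgesBetween (Graph.ofSimpleGraph G) u.1 v.1 = ∅ := by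
      ext e
      simp only [Set.mem_empty_iff_false, iff_false]
      rintro ⟨rfl, h⟩
      exact hadj h
    have h2 : edgesBetweenSets (permCover G m t ht).H ((permCover G m t ht).L u)
        ((permCover G m t ht).L v) = ∅ := by
      ext f
      simp only [Set.mem_empty_iff_false, iff_false]
      rintro ⟨x, rfl, y, rfl, rfl, h⟩
      exact hadj ((permCoverGraph_adj_of_ne (ht := ht) huv).1 h).1
    rw [h1, h2]
    simp

theorem isTransversal_permCover_iff (c : V(Graph.ofSimpleGraph G) → Fin m) :
    (permCover G m t ht).IsTransversal c ↔
      ∀ u v : V(Graph.ofSimpleGraph G), G.Adj u v → t u v (c u) ≠ c v := by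
  refine (Cover.isTransversal_iff (permCover G m t ht) c).trans ?_
  refine forall₂_congr fun u v => ?_
  rw [Graph.ofSimpleGraph_adj_iff]
  refine forall_congr' fun h => ?_
  refine not_congr ((Graph.ofSimpleGraph_adj_iff _ _).trans ?_)
  refine (permCoverGraph_adj_of_ne (fun h' => h.ne ?_)).trans ?_
  · exact congrArg Subtype.val h'
  · simp [h]

theorem numColorings_permCover [Finite V] :
    (permCover G m t ht).numColorings = {c : V(Graph.ofSimpleGraph G) → Fin m |
      ∀ u v : V(Graph.ofSimpleGraph G), G.Adj u v → t u v (c u) ≠ c v}.ncard := by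
  rw [Cover.numColorings_eq _ (Set.toFinite _)]
  congr 1
  ext c
  exact isTransversal_permCover_iff G m t ht c

theorem P_ofSimpleGraph_eq_numColorings [Finite V] :
    P (Graph.ofSimpleGraph G) m =
      (permCover G m (fun _ _ => 1) fun _ _ => inv_one.symm).numColorings := by
  rw [numColorings_permCover, P]
  congr 1
  ext c
  refine forall₂_congr fun u v => ?_
  rw [Graph.ofSimpleGraph_adj_iff]
  simp

theorem PDP_le_numColorings_permCover :
    PDP (Graph.ofSimpleGraph G) m ≤ (permCover G m t ht).numColorings :=
  Nat.sInf_le ⟨_, isFullFold_permCover G m t ht, rfl⟩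

theorem PDP_le_P_ofSimpleGraph [Finite V] :
    PDP (Graph.ofSimpleGraph G) m ≤ P (Graph.ofSimpleGraph G) m := by
  rw [P_ofSimpleGraph_eq_numColorings]
  exact PDP_le_numColorings_permCover G m _ _

end

end permCover

/-! ### Exactly six colorings at m = 3 -/

theorem six_le_PDP_Hk (k : ℕ) : 6 ≤ PDP (Hk k) 3 := by
  -- The infimum of an empty set is 0 in ℕ, so some full cover must be exhibited; the identity cover
  -- serves.
  have hne : {n | ∃ C : Cover (Hk k), C.IsFullFold 3 ∧ C.numColorings = n}.Nonempty :=
    ⟨_, _, isFullFold_permCover (simpleHk k) 3 (fun _ _ => 1) fun _ _ => inv_one.symm, rfl⟩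
  obtain ⟨C, hC, h⟩ := Nat.sInf_mem hne
  rw [PDP, ← h]
  exact six_le_numColorings C hC.1

theorem P_Hk_three_le (k : ℕ) : P (Hk k) 3 ≤ 6 := by
  let w : V(Hk k) := ⟨some (Sum.inl 0), trivial⟩
  let p (i : Fin (2 * k + 1 + 1)) : V(Hk k) := ⟨some (Sum.inr i), trivial⟩
  let z : V(Hk k) := ⟨none, trivial⟩
  have hfin : Finite V(Hk k) := Set.toFinite (Set.univ)
  have hcol : ∀ c : V(Hk k) → Fin 3, IsProperColoring (Hk k) 3 c →
      (∀ i, c w ≠ c (p i)) ∧ (∀ i : Fin (2 * k + 1), c (p i.castSucc) ≠ c (p i.succ)) ∧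
      c z ≠ c (p 0) ∧ c z ≠ c (p (Fin.last _)) := by
    intro c hc
    exact (forall_adj_simpleHk_iff (k := k) (Q := fun u v => c ⟨u, trivial⟩ ≠ c ⟨v, trivial⟩)
      (fun u v h => h.symm)).1 fun u v huv =>
        hc ⟨u, trivial⟩ ⟨v, trivial⟩ ((Graph.ofSimpleGraph_adj_iff u v).2 huv)
  have hpar : ∀ c : V(Hk k) → Fin 3, IsProperColoring (Hk k) 3 c → ∀ i : Fin (2 * k + 1 + 1),
      c (p i) = c (p 0) ↔ Even i.val := by
    intro c hc i
    obtain ⟨h1, h2, -, -⟩ := hcol c hc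
    induction i using Fin.induction with
    | zero => simp
    | succ i ih =>
      -- Only two colors avoid the hub, so each step along the path switches between them.
      have aux : ∀ a x y y' : Fin 3, a ≠ x → a ≠ y → a ≠ y' → y ≠ y' → (y' = x ↔ ¬ y = x) := by
        decide
      rw [aux _ _ _ _ (h1 0) (h1 i.castSucc) (h1 i.succ) (h2 i), ih]
      simp [Nat.even_add_one]
  have hinj : Set.InjOn (fun c : V(Hk k) → Fin 3 => (c w, c (p 0)))
      {c | IsProperColoring (Hk k) 3 c} := by
    intro c hc c' hc' heq
    obtain ⟨h1, -, h3, h4⟩ := hcol c hc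
    obtain ⟨h1', -, h3', h4'⟩ := hcol c' hc'
    obtain ⟨hw, h0⟩ := Prod.mk.inj heq
    -- The last index is odd, so the ends of the path differ and the extra vertex is forced to take
    -- the hub color.
    have hodd : ¬ Even (Fin.last (2 * k + 1)).val := by simp
    have aux : ∀ a x y y' : Fin 3, a ≠ x → a ≠ y → a ≠ y' → (y = x ↔ y' = x) → y = y' := by
      decide
    have aux' : ∀ a x y b : Fin 3, a ≠ x → a ≠ y → ¬ y = x → b ≠ x → b ≠ y → b = a := by
      decide
    funext v
    obtain ⟨_ | a | i, hv⟩ := v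
    · rw [show c ⟨none, hv⟩ = c w from aux' _ _ _ _ (h1 0) (h1 _) ((hpar c hc _).not.2 hodd) h3 h4,
        show c' ⟨none, hv⟩ = c' w from aux' _ _ _ _ (h1' 0) (h1' _) ((hpar c' hc' _).not.2 hodd) h3' h4', hw]
    · rw [Subsingleton.elim a 0]
      exact hw
    · refine aux _ _ _ _ (h1 0) (h1 i) (hw ▸ h1' i) ?_
      have e1 := hpar c hc i
      have e2 := hpar c' hc' i
      rw [← h0, ← e1] at e2
      exact e2.symm
  rw [P, ← hinj.ncard_image]
  calc _ ≤ ((Finset.univ.offDiag : Finset (Fin 3 × Fin 3)) : Set (Fin 3 × Fin 3)).ncard := by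
        refine Set.ncard_le_ncard ?_
        rintro _ ⟨c, hc, rfl⟩
        simpa using (hcol c hc).1 0
    _ = 6 := by rw [Set.ncard_coe_finset]; rfl

theorem PDP_Hk_three (k : ℕ) : PDP (Hk k) 3 = P (Hk k) 3 :=
  le_antisymm (PDP_le_P_ofSimpleGraph _ 3) ((P_Hk_three_le k).trans (six_le_PDP_Hk k))

/-- The hub and the first two path vertices form a triangle. -/
theorem three_le_of_isProperColoring {k m : ℕ} {c : V(Hk k) → Fin m}
    (hc : IsProperColoring (Hk k) m c) : 3 ≤ m := by
  obtain ⟨h1, h2, -, -⟩ := (forall_adj_simpleHk_iff (k := k)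
    (Q := fun u v => c ⟨u, trivial⟩ ≠ c ⟨v, trivial⟩) (fun u v h => h.symm)).1 fun u v huv =>
      hc ⟨u, trivial⟩ ⟨v, trivial⟩ ((Graph.ofSimpleGraph_adj_iff u v).2 huv)
  have a1 := h1 (Fin.castSucc 0)
  have a2 := h1 (Fin.succ 0)
  have a3 := h2 0
  simp only [ne_eq, Fin.ext_iff] at a1 a2 a3
  omega

theorem chi_Hk_le (k : ℕ) : chi (Hk k) ≤ 3 := by
  refine Nat.sInf_le ?_
  by_contra h
  have h0 : P (Hk k) 3 = 0 := by
    rw [P, Set.ncard_eq_zero]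
    ext c
    simpa using fun hc => h ⟨c, hc⟩
  have := six_le_PDP_Hk k
  rw [PDP_Hk_three] at this
  omega

theorem chiDP_Hk (k : ℕ) : chiDP (Hk k) = 3 := by
  have hfin : V(Hk k).Finite := Set.toFinite (Set.univ)
  have h3 : 3 ∈ {n | 0 < n ∧ ∀ C : Cover (Hk k), C.IsFold n → ∃ I, C.IsColoring I} := by
    refine ⟨by norm_num, fun C hC => ?_⟩
    have := six_le_numColorings C hC
    exact Set.nonempty_of_ncard_ne_zero (s := {I | C.IsColoring I})
      (by unfold Cover.numColorings at this; omega)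
  refine le_antisymm (Nat.sInf_le h3) (le_csInf ⟨3, h3⟩ ?_)
  rintro n ⟨hn, hC⟩
  have : NeZero n := ⟨hn.ne'⟩
  -- A coloring of the identity cover is a proper coloring, so the triangle bound applies.
  obtain ⟨I, hI⟩ := hC _ (isFold_permCover (simpleHk k) n (fun _ _ => 1) fun _ _ => inv_one.symm)
  obtain ⟨c, hc, -⟩ := (Cover.isColoring_iff _ hfin I).1 hI
  refine three_le_of_isProperColoring (k := k) (c := c) fun u v huv => ?_
  exact (isTransversal_permCover_iff _ _ _ _ c).1 hc u v
    ((Graph.ofSimpleGraph_adj_iff u.1 v.1).1 huv)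

theorem isFiniteLoopless_Hk (k : ℕ) : IsFiniteLoopless (Hk k) where
  vertexSet_nonempty := ⟨none, trivial⟩
  vertexSet_finite := Set.toFinite (Set.univ)
  edgeSet_finite := Set.toFinite _
  loopless := (simple_ofSimpleGraph _).toLoopless

theorem Isomorphic.eq_of_Hk {j k : ℕ} (h : Isomorphic (Hk j) (Hk k)) : j = k := by
  obtain ⟨φ, -⟩ := h
  have hcard : ∀ i, Nat.card V(Hk i) = 2 * i + 4 := by
    intro i
    have : V(Hk i) = Set.univ := rfl
    rw [this, Nat.card_univ, Nat.card_eq_fintype_card]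
    simp only [Fintype.card_option, Fintype.card_sum, Fintype.card_fin]
    omega
  have := Nat.card_congr φ
  rw [hcard, hcard] at this
  omega

/-! ### Counting path colorings with prescribed ends -/

/-- The maps `g` on the path with `n + 1` vertices that properly color it, avoid `a`, start at `i`
and end at `j`. -/
def pathColorings {m : ℕ} (a : Fin m) (n : ℕ) (i j : Fin m) : Finset (Fin (n + 1) → Fin m) :=
  {g | (∀ s, a ≠ g s) ∧ (∀ s : Fin n, g s.castSucc ≠ g s.succ) ∧ g 0 = i ∧ g (Fin.last n) = j}

section pathColorings

variable {m : ℕ} {a i j : Fin m} {n : ℕ}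

theorem mem_pathColorings {g : Fin (n + 1) → Fin m} :
    g ∈ pathColorings a n i j ↔
      (∀ s, a ≠ g s) ∧ (∀ s : Fin n, g s.castSucc ≠ g s.succ) ∧ g 0 = i ∧ g (Fin.last n) = j := by
  simp [pathColorings]

theorem cons_mem_pathColorings {x : Fin m} {g : Fin (n + 1) → Fin m} :
    (Fin.cons x g : Fin (n + 2) → Fin m) ∈ pathColorings a (n + 1) i j ↔
      (a ≠ i ∧ x = i ∧ i ≠ g 0) ∧ g ∈ pathColorings a n (g 0) j := by
  have h1 : (∀ s, a ≠ (Fin.cons x g : Fin (n + 2) → Fin m) s) ↔ a ≠ x ∧ ∀ s, a ≠ g s := by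
    rw [Fin.forall_fin_succ]
    simp
  have h2 : (∀ s : Fin (n + 1), (Fin.cons x g : Fin (n + 2) → Fin m) s.castSucc ≠
      (Fin.cons x g : Fin (n + 2) → Fin m) s.succ) ↔
      x ≠ g 0 ∧ ∀ s : Fin n, g s.castSucc ≠ g s.succ := by
    rw [Fin.forall_fin_succ]
    simp only [Fin.cons_succ, Fin.castSucc_zero, Fin.cons_zero, ← Fin.succ_castSucc]
  rw [mem_pathColorings, mem_pathColorings, h1, h2, ← Fin.succ_last, Fin.cons_zero, Fin.cons_succ]
  constructor
  · rintro ⟨⟨h1, h2⟩, ⟨h3, h4⟩, rfl, h6⟩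
    exact ⟨⟨h1, rfl, h3⟩, h2, h4, rfl, h6⟩
  · rintro ⟨⟨h1, rfl, h3⟩, h2, h4, -, h6⟩
    exact ⟨⟨h1, h2⟩, ⟨h3, h4⟩, rfl, h6⟩

theorem card_pathColorings_succ (hi : a ≠ i) :
    (pathColorings a (n + 1) i j).card =
      ∑ x ∈ Finset.univ.erase i, (pathColorings a n x j).card := by
  have hmaps : ∀ g ∈ pathColorings a (n + 1) i j, g 1 ∈ Finset.univ.erase i := by
    intro g hg
    have := (mem_pathColorings.1 hg).2
    simpa [this.2.1] using (this.1 0).symm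
  rw [Finset.card_eq_sum_card_fiberwise hmaps]
  refine Finset.sum_congr rfl fun x hx => ?_
  refine Finset.card_bij' (fun g _ => Fin.tail g) (fun g _ => Fin.cons i g) ?_ ?_ ?_ ?_
  · intro g hg
    obtain ⟨hg, hx⟩ := Finset.mem_filter.1 hg
    rw [← Fin.cons_self_tail g] at hg
    have := (cons_mem_pathColorings.1 hg).2
    rwa [Fin.tail, Fin.succ_zero_eq_one, hx] at this
  · intro g hg
    have h0 := (mem_pathColorings.1 hg).2.2.1
    refine Finset.mem_filter.2 ⟨cons_mem_pathColorings.2 ⟨⟨hi, rfl, ?_⟩, ?_⟩, ?_⟩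
    · rw [h0]
      exact (Finset.ne_of_mem_erase hx).symm
    · rwa [h0]
    · rw [← Fin.succ_zero_eq_one, Fin.cons_succ, h0]
  · intro g hg
    have h0 := (mem_pathColorings.1 (Finset.mem_filter.1 hg).1).2.2.1
    rw [← h0]
    exact Fin.cons_self_tail g
  · intro g _
    exact Fin.tail_cons _ _

theorem pathColorings_eq_empty (h : a = i ∨ a = j) : pathColorings a n i j = ∅ := by
  ext g
  simp only [mem_pathColorings, Finset.notMem_empty, iff_false]
  rintro ⟨h1, -, rfl, rfl⟩
  rcases h with h | h
  · exact h1 _ h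
  · exact h1 _ h

/-- The second vertex has m - 2 admissible colors x, those other than a and i. Each contributes β,
except that x = j contributes α, and j is admissible exactly when i ≠ j. So the gap between equal
and distinct ends changes sign with each added edge. -/
theorem card_pathColorings_succ_of_card {α β : ℤ}
    (h : ∀ x y : Fin m, a ≠ x → a ≠ y →
      ((pathColorings a n x y).card : ℤ) = if x = y then α else β) (hi : a ≠ i) (hj : a ≠ j) :
    ((pathColorings a (n + 1) i j).card : ℤ) =
      if i = j then (m - 2) * β else (m - 2) * β + (α - β) := by
  have hmem : a ∈ Finset.univ.erase i := by simpa using hi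
  have hm : 2 ≤ m := by
    have := i.2
    have := a.2
    have := Fin.val_ne_iff.2 hi
    omega
  rw [card_pathColorings_succ hi, ← Finset.add_sum_erase _ _ hmem,
    pathColorings_eq_empty (Or.inl rfl), Finset.card_empty, zero_add, Nat.cast_sum]
  have : ∀ x ∈ (Finset.univ.erase i).erase a,
      ((pathColorings a n x j).card : ℤ) = β + if x = j then α - β else 0 := by
    intro x hx
    rw [h x j (Finset.ne_of_mem_erase hx).symm hj]
    split_ifs <;> ring
  rw [Finset.sum_congr rfl this, Finset.sum_add_distrib, Finset.sum_const, Finset.sum_ite_eq',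
    Finset.card_erase_of_mem hmem, Finset.card_erase_of_mem (Finset.mem_univ i), Finset.card_univ,
    Fintype.card_fin, nsmul_eq_mul, Nat.sub_sub, Nat.cast_sub (by omega)]
  by_cases hij : i = j
  · simp [hij]
  · simp [hij, hj.symm, Ne.symm hij]

/-- Two steps of the recursion restore the gap of 1 and send α to (m - 2)((m - 2)(α + 1) - 1),
starting from α = 0 on a single edge. -/
theorem exists_card_pathColorings_odd (hm : 5 ≤ m) (k : ℕ) :
    ∃ α : ℤ, (∀ a i j : Fin m, a ≠ i → a ≠ j →
      ((pathColorings a (2 * k + 1) i j).card : ℤ) = if i = j then α else α + 1) ∧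
      0 ≤ α ∧ (1 ≤ k → (m : ℤ) - 2 < α) := by
  have hm' : (5 : ℤ) ≤ m := by exact_mod_cast hm
  induction k with
  | zero =>
    refine ⟨0, fun a i j hi hj => ?_, le_rfl, by simp⟩
    have h0 : ∀ x y : Fin m, a ≠ x → a ≠ y →
        ((pathColorings a 0 x y).card : ℤ) = if x = y then 1 else 0 := by
      intro x y hx hy
      by_cases hxy : x = y
      · subst hxy
        have : pathColorings a 0 x x = {fun _ => x} := by
          ext g
          rw [mem_pathColorings, Finset.mem_singleton]
          constructor
          · rintro ⟨-, -, h, -⟩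
            funext s
            rw [show s = 0 from Subsingleton.elim (α := Fin 1) s 0, h]
          · rintro rfl
            exact ⟨fun _ => hx, fun s => s.elim0, rfl, rfl⟩
        simp [this]
      · have : pathColorings a 0 x y = ∅ := by
          ext g
          simp only [mem_pathColorings, Finset.notMem_empty, iff_false]
          rintro ⟨-, -, rfl, rfl⟩
          exact hxy rfl
        simp [this, hxy]
    rw [card_pathColorings_succ_of_card h0 hi hj]
    simp
  | succ k ih =>
    obtain ⟨α, h, hα, -⟩ := ih
    refine ⟨(m - 2) * ((m - 2) * (α + 1) - 1), fun a i j hi hj => ?_, ?_, fun _ => ?_⟩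
    · have h2 := fun x y hx hy => card_pathColorings_succ_of_card (i := x) (j := y) (h a) hx hy
      rw [show 2 * (k + 1) + 1 = (2 * k + 1 + 1) + 1 by ring,
        card_pathColorings_succ_of_card h2 hi hj]
      split_ifs <;> ring
    · exact mul_nonneg (by linarith) (by nlinarith)
    · have h3 : (2 : ℤ) ≤ (m - 2) * (α + 1) - 1 := by nlinarith
      nlinarith

end pathColorings

/-! ### Fan colorings and the twisted cover -/

/-- The proper colorings of the fan `K₁ ∨ P_{n+1}`. -/
def fanColorings (m n : ℕ) : Finset (Fin m × (Fin (n + 1) → Fin m)) :=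
  {x | (∀ s, x.1 ≠ x.2 s) ∧ ∀ s : Fin n, x.2 s.castSucc ≠ x.2 s.succ}

theorem card_filter_fanColorings (m n : ℕ) (ρ : Fin m → Fin m) :
    ((fanColorings m n).filter fun x => ρ (x.2 0) = x.2 (Fin.last n)).card =
      ∑ a, ∑ i, (pathColorings a n i (ρ i)).card := by
  rw [← Finset.sum_product', Finset.card_eq_sum_card_fiberwise
    (f := fun x : Fin m × (Fin (n + 1) → Fin m) => (x.1, x.2 0)) (t := Finset.univ ×ˢ Finset.univ)
    (fun _ _ => by simp)]
  refine Finset.sum_congr rfl fun p _ => ?_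
  refine Finset.card_bij' (fun x _ => x.2) (fun g _ => (p.1, g)) ?_ ?_ ?_ ?_
  · rintro ⟨a, g⟩ hx
    simp only [fanColorings, Finset.mem_filter, Finset.mem_univ, true_and] at hx
    obtain ⟨⟨⟨h1, h2⟩, h3⟩, rfl⟩ := hx
    exact mem_pathColorings.2 ⟨h1, h2, rfl, h3.symm⟩
  · intro g hg
    obtain ⟨h1, h2, h3, h4⟩ := mem_pathColorings.1 hg
    simp only [fanColorings, Finset.mem_filter, Finset.mem_univ, true_and]
    exact ⟨⟨⟨h1, h2⟩, by rw [h3, h4]⟩, by rw [h3]⟩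
  · rintro ⟨a, g⟩ hx
    rw [← (Finset.mem_filter.1 hx).2]
  · intro g _
    rfl

theorem card_filter_ne_and_ne {m : ℕ} (x y : Fin m) :
    (Finset.univ.filter fun z => x ≠ z ∧ y ≠ z).card + 2 = m + if x = y then 1 else 0 := by
  have h : (Finset.univ.filter fun z => x ≠ z ∧ y ≠ z) = ({x, y} : Finset (Fin m))ᶜ := by
    ext z
    simp [eq_comm]
  rw [h, Finset.card_compl, Fintype.card_fin]
  have hle : ({x, y} : Finset (Fin m)).card ≤ m := by
    simpa using Finset.card_le_univ ({x, y} : Finset (Fin m))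
  by_cases hxy : x = y
  · subst hxy
    simp only [Finset.pair_eq_singleton, Finset.card_singleton, if_true] at hle ⊢
    omega
  · rw [Finset.card_pair hxy] at hle ⊢
    simp only [hxy, if_false]
    omega

/-- For each color i of the first path vertex, the claim is (m - 2)(α + 1) < (m - 1)α: the factors m
- 2 and m - 1 count hub colors avoiding both ends, and the inequality is m - 2 < α. -/
theorem card_filter_fanColorings_lt {m k : ℕ} (hm : 5 ≤ m) (hk : 1 ≤ k) {ρ : Fin m → Fin m}
    (hρ : ∀ i, ρ i ≠ i) :
    ((fanColorings m (2 * k + 1)).filter fun x => ρ (x.2 0) = x.2 (Fin.last _)).card <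
      ((fanColorings m (2 * k + 1)).filter fun x => x.2 0 = x.2 (Fin.last _)).card := by
  have h1 := card_filter_fanColorings m (2 * k + 1) ρ
  have h2 := card_filter_fanColorings m (2 * k + 1) id
  simp only [id] at h2
  rw [h1, h2, Finset.sum_comm]
  rw [Finset.sum_comm (f := fun a i => (pathColorings a (2 * k + 1) i i).card)]
  have : NeZero m := ⟨by omega⟩
  refine Finset.sum_lt_sum_of_nonempty Finset.univ_nonempty fun i _ => ?_
  obtain ⟨α, hα, -, hlt⟩ := exists_card_pathColorings_odd hm k
  have hlt := hlt hk
  have hsum : ∀ j, ((∑ a, (pathColorings a (2 * k + 1) i j).card : ℕ) : ℤ) =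
      (Finset.univ.filter fun a => i ≠ a ∧ j ≠ a).card * if i = j then α else α + 1 := by
    intro j
    rw [← nsmul_eq_mul, ← Finset.sum_const, Finset.sum_filter, Nat.cast_sum]
    refine Finset.sum_congr rfl fun a _ => ?_
    split_ifs with h
    · rw [hα a i j h.1.symm h.2.symm]
      simp_all
    · rw [hα a i j h.1.symm h.2.symm]
      simp_all
    · rw [pathColorings_eq_empty (by tauto)]
      rfl
  have e1 := card_filter_ne_and_ne i (ρ i)
  have e2 := card_filter_ne_and_ne i i
  rw [if_neg (hρ i).symm] at e1
  rw [if_pos rfl] at e2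
  zify at e1 e2 ⊢
  have s1 := hsum (ρ i)
  have s2 := hsum i
  rw [if_neg (hρ i).symm] at s1
  rw [if_pos rfl] at s2
  push_cast at s1 s2
  rw [s1, s2]
  nlinarith

/-- The permutations `1` on all edges of `H_k` but one, where it is `ρ`. -/
def twist (k m : ℕ) (ρ : Equiv.Perm (Fin m)) (u v : Option (Fin 1 ⊕ Fin (2 * k + 2))) :
    Equiv.Perm (Fin m) :=
  if u = none ∧ v = some (Sum.inr 0) then ρ⁻¹
  else if v = none ∧ u = some (Sum.inr 0) then ρ else 1

theorem twist_symm (k m : ℕ) (ρ : Equiv.Perm (Fin m)) (u v : Option (Fin 1 ⊕ Fin (2 * k + 2))) :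
    twist k m ρ v u = (twist k m ρ u v)⁻¹ := by
  unfold twist
  by_cases h1 : u = none ∧ v = some (Sum.inr 0)
  · obtain ⟨rfl, rfl⟩ := h1
    simp
  · by_cases h2 : v = none ∧ u = some (Sum.inr 0)
    · obtain ⟨rfl, rfl⟩ := h2
      simp
    · simp [h1, h2]

theorem twist_one (k m : ℕ) : twist k m 1 = fun _ _ => 1 := by
  funext u v
  simp [twist]

/-- The extra vertex must avoid the ρ-image of one path end and the color of the other: m - 2
choices, or m - 1 if these coincide. The term 2 · (number of fan colorings) stands on the left to
avoid truncated subtraction. -/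
theorem numColorings_twist (k m : ℕ) [NeZero m] (ρ : Equiv.Perm (Fin m)) :
    (permCover (simpleHk k) m (twist k m ρ) (twist_symm k m ρ)).numColorings +
        2 * (fanColorings m (2 * k + 1)).card =
      m * (fanColorings m (2 * k + 1)).card +
        ((fanColorings m (2 * k + 1)).filter fun x => ρ (x.2 0) = x.2 (Fin.last _)).card := by
  let S : Finset ((Fin m × (Fin (2 * k + 1 + 1) → Fin m)) × Fin m) :=
    {x | x.1 ∈ fanColorings m (2 * k + 1) ∧ ρ (x.1.2 0) ≠ x.2 ∧ x.1.2 (Fin.last _) ≠ x.2}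
  have hS : S.card = ∑ x ∈ fanColorings m (2 * k + 1),
      (Finset.univ.filter fun z => ρ (x.2 0) ≠ z ∧ x.2 (Fin.last _) ≠ z).card := by
    rw [Finset.card_eq_sum_card_fiberwise (f := Prod.fst) (t := fanColorings m (2 * k + 1))
      (fun x hx => (Finset.mem_filter.1 hx).2.1)]
    refine Finset.sum_congr rfl fun x hx => ?_
    refine Finset.card_bij' (fun y _ => y.2) (fun z _ => (x, z)) ?_ ?_ ?_ ?_
    · intro y hy
      obtain ⟨hyS, rfl⟩ := Finset.mem_filter.1 hy
      exact Finset.mem_filter.2 ⟨Finset.mem_univ _, (Finset.mem_filter.1 hyS).2.2⟩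
    · intro z hz
      have := (Finset.mem_filter.1 hz).2
      refine Finset.mem_filter.2 ⟨Finset.mem_filter.2 ⟨Finset.mem_univ _, hx, this⟩, rfl⟩
    · intro y hy
      rw [← (Finset.mem_filter.1 hy).2]
    · intro z _
      rfl
  have hnum : (permCover (simpleHk k) m (twist k m ρ) (twist_symm k m ρ)).numColorings
      = S.card := by
    rw [numColorings_permCover, ← Set.ncard_coe_finset]
    let φ : (V(Graph.ofSimpleGraph (simpleHk k)) → Fin m) → (Fin m × (Fin (2 * k + 1 + 1) → Fin m)) × Fin m := fun c =>
      ((c ⟨some (Sum.inl 0), trivial⟩, fun i => c ⟨some (Sum.inr i), trivial⟩), c ⟨none, trivial⟩)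
    have hφ : Function.Injective φ := by
      intro c c' h
      simp only [φ, Prod.mk.injEq] at h
      obtain ⟨⟨h1, h2⟩, h3⟩ := h
      funext v
      obtain ⟨_ | a | i, hv⟩ := v
      · exact h3
      · rw [Subsingleton.elim a 0]
        exact h1
      · exact congrFun h2 i
    have hiff : ∀ c : V(Hk k) → Fin m,
        (∀ u v : V(Graph.ofSimpleGraph (simpleHk k)), (simpleHk k).Adj u v →
          twist k m ρ u v (c u) ≠ c v) ↔ φ c ∈ S := by
      intro c
      have := forall_adj_simpleHk_iff (k := k) (Q := fun u v =>
        twist k m ρ u v (c ⟨u, trivial⟩) ≠ c ⟨v, trivial⟩) (fun u v h h' => h (by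
          rw [← h', twist_symm k m ρ v u]; simp))
      refine Iff.trans ⟨fun h u v huv => h ⟨u, trivial⟩ ⟨v, trivial⟩ huv,
        fun h u v huv => h u v huv⟩ (this.trans ?_)
      have e1 : ∀ x y, ρ.symm x = y ↔ ρ y = x := fun x y => by
        rw [Equiv.symm_apply_eq, eq_comm]
      simp only [twist, S, φ, fanColorings, Finset.mem_filter, Finset.mem_univ, true_and]
      simp [e1, eq_comm (a := c ⟨none, trivial⟩), and_assoc]
      exact Iff.rfl
    rw [← Set.ncard_image_of_injective _ hφ]
    congr 1
    ext ⟨⟨a, g⟩, z⟩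
    constructor
    · rintro ⟨c, hc, h⟩
      rw [← h]
      exact (hiff c).1 hc
    · intro h
      let c : V(Hk k) → Fin m := fun v => match v with
        | ⟨none, _⟩ => z
        | ⟨some (Sum.inl _), _⟩ => a
        | ⟨some (Sum.inr i), _⟩ => g i
      exact ⟨c, (hiff c).2 h, rfl⟩
  have hsum := Finset.sum_congr (rfl : fanColorings m (2 * k + 1) = _) fun x _ =>
    card_filter_ne_and_ne (ρ (x.2 0)) (x.2 (Fin.last (2 * k + 1)))
  rw [Finset.sum_add_distrib, Finset.sum_add_distrib, ← hS, ← Finset.card_filter,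
    Finset.sum_const, Finset.sum_const, smul_eq_mul, smul_eq_mul] at hsum
  rw [hnum]
  linarith

theorem PDP_Hk_lt {k m : ℕ} (hk : 1 ≤ k) (hm : 5 ≤ m) : PDP (Hk k) m < P (Hk k) m := by
  have : NeZero m := ⟨by omega⟩
  have h1 : (permCover (simpleHk k) m (twist k m 1) (twist_symm k m 1)).numColorings +
      2 * (fanColorings m (2 * k + 1)).card = m * (fanColorings m (2 * k + 1)).card +
        ((fanColorings m (2 * k + 1)).filter fun x => x.2 0 = x.2 (Fin.last _)).card := by
    convert numColorings_twist k m 1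
    rfl
  -- The cyclic shift is used only as a permutation without fixed points.
  have h2 := numColorings_twist k m (finRotate m)
  have h3 := card_filter_fanColorings_lt hm hk (ρ := finRotate m) (by
    obtain ⟨n, rfl⟩ : ∃ n, m = n + 1 + 1 := ⟨m - 2, by omega⟩
    intro i h
    rw [finRotate_apply] at h
    simp at h)
  have h4 := PDP_le_numColorings_permCover (simpleHk k) m _ (twist_symm k m (finRotate m))
  have h5 : P (Hk k) m =
      (permCover (simpleHk k) m (twist k m 1) (twist_symm k m 1)).numColorings := by
    refine (P_ofSimpleGraph_eq_numColorings (simpleHk k) m).trans ?_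
    congr 2
    rw [twist_one]
  change PDP (Hk k) m ≤ _ at h4
  -- The nonlinear product is common to both counts; as an atom it cancels in linear arithmetic.
  generalize m * (fanColorings m (2 * k + 1)).card = T at h1 h2
  omega

theorem not_isChromaticAdherentAt_Hk {k : ℕ} (hk : 1 ≤ k) :
    ¬ IsChromaticAdherentAt PDP (Hk k) := fun h =>
  (PDP_Hk_lt hk le_rfl).ne (h 3 (chi_Hk_le k) (PDP_Hk_three k) 5 (by norm_num))

end DPColoring

theorem theorem3 :
    (∀ k : ℕ, 1 ≤ k →
      DPColoring.IsFiniteLoopless (DPColoring.Hk k) ∧ (DPColoring.Hk k).Simple ∧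
      DPColoring.chiDP (DPColoring.Hk k) = 3 ∧
      DPColoring.PDP (DPColoring.Hk k) 3 = DPColoring.P (DPColoring.Hk k) 3 ∧
      (∃ N : ℕ, ∀ m : ℕ, N ≤ m →
        DPColoring.PDP (DPColoring.Hk k) m < DPColoring.P (DPColoring.Hk k) m) ∧
      ¬ DPColoring.IsChromaticAdherentAt DPColoring.PDP (DPColoring.Hk k)) ∧
    (∀ j k : ℕ, 1 ≤ j → 1 ≤ k → j ≠ k →
      ¬ DPColoring.Isomorphic (DPColoring.Hk j) (DPColoring.Hk k)) ∧
    ¬ DPColoring.IsChromaticAdherent DPColoring.PDP := by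
  refine ⟨fun k hk => ⟨DPColoring.isFiniteLoopless_Hk k, DPColoring.simple_ofSimpleGraph _,
    DPColoring.chiDP_Hk k, DPColoring.PDP_Hk_three k, ⟨5, fun m hm => DPColoring.PDP_Hk_lt hk hm⟩,
    DPColoring.not_isChromaticAdherentAt_Hk hk⟩, fun j k _ _ hjk h => hjk h.eq_of_Hk, fun h => ?_⟩
  exact DPColoring.not_isChromaticAdherentAt_Hk le_rfl
    (h _ _ (DPColoring.Hk 1) (DPColoring.isFiniteLoopless_Hk 1))
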